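/- All rings are commutative. Let $p$ be a prime and let $R$ be a Noetherian ring of characteristic $p$. For $e\ge 0$ put $q=p^e$ and let $R^{(e)}$ be the $R$-algebra which is $R$ as a ring, with $R$-algebra structure $r\cdot s=r^{q}s$. The ring $R$ is *F-finite* if $R^{(e)}$ is a finitely generated $R$-module for all $e$. It is *locally equidimensional* if for every $P\in\operatorname{Spec}R$ and every minimal prime $\mathfrak p$ of $R_P$ one has $\dim(R_P/\mathfrak p)=\dim R_P$. For a Noetherian local ring $(A,\mathfrak m,k)$ of characteristic $p$ let $\psi:k\to E_A(k)$ be the inclusion of the residue field into its injective hull, let $K_e$ be the image of $1\otimes\psi: A^{(e)}\otimes_A k\to A^{(e)}\otimes_A E_A(k)$ (an $A^{(e)}$-module of finite length), and define the *$e$-th normalized Frobenius splitting number* $$s_e(A)=\frac{\lambda_{A^{(e)}}(K_e)}{q^{\dim A}}.$$ If $A$ is F-finite, put $\alpha(A)=\log_p[k:k^p]$ and define the *$e$-th Frobenius splitting number* $a_e(A)=s_e(A)\cdot q^{\dim A+\alpha(A)}$. For a prime $P$ of $R$ write $s_e(P)=s_e(R_P)$ and, when $R_P$ is F-finite, $a_e(P)=a_e(R_P)$.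 Let $R$ be an F-finite, locally equidimensional Noetherian ring of prime characteristic $p$. Then $R_P$ is F-finite for every $P\in\operatorname{Spec}R$, and for every $e\ge 0$: 1. $a_e$ and $s_e$ are well-defined functions $\operatorname{Spec}R\to\mathbb Q$; 2. both $s_e$ and $a_e$ are lower semicontinuous, i.e. $\{P: s_e(P)>r\}$ and $\{P: a_e(P)>r\}$ are open in $\operatorname{Spec}R$ for all $r\in\mathbb R$; 3. $s_e$ and $a_e$ are proportional on each connected component of $\operatorname{Spec}R$: for every connected component $C$ there is a real constant $c>0$ (which may depend on $C$ and $e$) such that $a_e(P)=c\cdot s_e(P)$ for all $P\in C$. -/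

import Mathlib

open scoped TensorProduct

universe u

/-- `ψ : M → E` exhibits `E` as an injective hull of `M`: `E` is injective, `ψ` is a monomorphism,
and `E` is an essential extension of the image of `M`. -/
structure IsInjectiveHull {R M E : Type u} [CommRing R] [AddCommGroup M] [Module R M]
    [AddCommGroup E] [Module R E] (ψ : M →ₗ[R] E) : Prop where
  injective_module : Module.Injective R E
  injective : Function.Injective ψ
  essential : ∀ N : Submodule R E, N ⊓ LinearMap.range ψ = ⊥ → N = ⊥

/-- Every module has an injective hull. -/
theorem exists_isInjectiveHull (R M : Type u) [CommRing R] [AddCommGroup M] [Module R M] :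
    ∃ (E : ModuleCat.{u} R) (ψ : M →ₗ[R] E), IsInjectiveHull ψ := by
  obtain ⟨J, hJ, f, hf⟩ : ∃ (J : ModuleCat.{u} R) (_ : Module.Injective R J) (f : M →ₗ[R] J),
      Function.Injective f := by
    obtain ⟨⟨J, hJ, f, hf⟩⟩ :=
      CategoryTheory.EnoughInjectives.presentation (ModuleCat.of R M)
    exact ⟨J, Module.injective_module_of_injective_object R J, f.hom,
      (ModuleCat.mono_iff_injective f).1 hf⟩
  -- maximal essential extensions of the image of `M` inside `J`
  let S : Set (Submodule R J) := {A | LinearMap.range f ≤ A ∧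
    ∀ x ∈ A, x ≠ 0 → ∃ r : R, r • x ≠ 0 ∧ r • x ∈ LinearMap.range f}
  obtain ⟨A, -, hA⟩ := zorn_le_nonempty₀ S (by
    intro c hc hchain B hB
    refine ⟨sSup c, ⟨(hc hB).1.trans (le_sSup hB), ?_⟩, fun z hz => le_sSup hz⟩
    intro x hx hx0
    obtain ⟨D, hD, hxD⟩ := (Submodule.mem_sSup_of_directed ⟨B, hB⟩ hchain.directedOn).1 hx
    exact (hc hD).2 x hxD hx0) (LinearMap.range f)
    ⟨le_rfl, fun x hx hx0 => ⟨1, by simpa using hx0, by simpa using hx⟩⟩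
  obtain ⟨hfA, hAess⟩ := hA.prop
  -- a complement of `A` inside `J`
  obtain ⟨C, -, hC⟩ := zorn_le_nonempty₀ {C : Submodule R J | Disjoint C A} (by
    intro c hc hchain B hB
    refine ⟨sSup c, ?_, fun z hz => le_sSup hz⟩
    refine Submodule.disjoint_def.2 fun x hx hxA => ?_
    obtain ⟨D, hD, hxD⟩ := (Submodule.mem_sSup_of_directed ⟨B, hB⟩ hchain.directedOn).1 hx
    exact Submodule.disjoint_def.1 (hc hD) x hxD hxA) ⊥ disjoint_bot_left
  have hCA : Disjoint C A := hC.prop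
  let i : A →ₗ[R] (J ⧸ C) := C.mkQ.comp A.subtype
  have hi : Function.Injective i := by
    rw [← LinearMap.ker_eq_bot, LinearMap.ker_eq_bot']
    intro a ha
    have h1 : (a : J) ∈ C := by simpa [i] using ha
    exact Subtype.ext (Submodule.disjoint_def.1 hCA a h1 a.2)
  obtain ⟨g, hg⟩ := hJ.out i hi A.subtype
  have hiess : ∀ y : J ⧸ C, y ≠ 0 → ∃ r : R, r • y ≠ 0 ∧ r • y ∈ LinearMap.range i := by
    intro y hy
    obtain ⟨x, rfl⟩ := C.mkQ_surjective y
    by_contra! hcon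
    have hD : Disjoint (C ⊔ Submodule.span R {x}) A := by
      refine Submodule.disjoint_def.2 fun z hz hzA => ?_
      obtain ⟨c, hc, w, hw, rfl⟩ := Submodule.mem_sup.1 hz
      obtain ⟨r, rfl⟩ := Submodule.mem_span_singleton.1 hw
      have hcz : C.mkQ c = 0 := by simpa using hc
      have h1 : i ⟨c + r • x, hzA⟩ = r • C.mkQ x := by
        simp only [i, LinearMap.comp_apply, Submodule.subtype_apply, map_add, map_smul, hcz,
          zero_add]
      have h2 : r • C.mkQ x = 0 := by
        by_contra h
        exact hcon r h ⟨_, h1⟩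
      have h3 := hi ((h1.trans h2).trans (map_zero i).symm)
      exact congrArg Subtype.val h3
    have h1 : C ⊔ Submodule.span R {x} ≤ C := hC.le_of_ge hD le_sup_left
    apply hy
    have h2 : x ∈ C := h1 (Submodule.mem_sup_right (Submodule.mem_span_singleton_self x))
    simpa using h2
  have hginj : Function.Injective g := by
    rw [← LinearMap.ker_eq_bot, LinearMap.ker_eq_bot']
    intro y hy
    by_contra hy0
    obtain ⟨r, hr0, a, ha⟩ := hiess y hy0
    have h1 : (a : J) = 0 := by
      have h2 := hg a
      rw [ha, map_smul, hy, smul_zero] at h2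
      exact h2.symm
    have h3 : a = 0 := Subtype.ext h1
    exact hr0 (by rw [← ha, h3, map_zero])
  have hArange : A ≤ LinearMap.range g := fun a ha => ⟨i ⟨a, ha⟩, hg ⟨a, ha⟩⟩
  have hrange : LinearMap.range g ≤ A := by
    refine hA.le_of_ge ⟨hfA.trans hArange, ?_⟩ hArange
    rintro _ ⟨y, rfl⟩ hy0
    obtain ⟨r, hr0, a, ha⟩ := hiess y (fun h => hy0 (by rw [h, map_zero]))
    have h1 : r • g y = (a : J) := by rw [← map_smul, ← ha]; exact hg a
    have h2 : (a : J) ≠ 0 := by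
      intro h
      have h3 : a = 0 := Subtype.ext h
      exact hr0 (by rw [← ha, h3, map_zero])
    obtain ⟨s, hs0, hs⟩ := hAess a a.2 h2
    exact ⟨s * r, by rwa [mul_smul, h1], by rwa [mul_smul, h1]⟩
  -- `J → J ⧸ C → A` is a retraction of `A ⊆ J`
  let π : J →ₗ[R] A := (g.comp C.mkQ).codRestrict A (fun x => hrange ⟨_, rfl⟩)
  have hπ : ∀ a : A, π a = a := fun a => Subtype.ext (hg a)
  refine ⟨ModuleCat.of R A, f.codRestrict A (fun m => hfA ⟨m, rfl⟩), ⟨⟨?_⟩, ?_, ?_⟩⟩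
  · intro X Y _ _ _ _ k hk l
    obtain ⟨h, hh⟩ := hJ.out k hk (A.subtype.comp l)
    exact ⟨π.comp h, fun x => by
      rw [LinearMap.comp_apply, hh]
      exact hπ (l x)⟩
  · intro m m' hm
    exact hf (congrArg Subtype.val hm)
  · intro N hN
    rw [Submodule.eq_bot_iff]
    intro x hx
    by_contra hx0
    obtain ⟨r, hr0, m, hm⟩ := hAess (x : A) (x : A).2
      (fun h => hx0 (Subtype.ext h))
    have h1 : r • x ∈ (⊥ : Submodule R _) := by
      rw [← hN]
      exact ⟨N.smul_mem r hx, m, Subtype.ext hm⟩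
    exact hr0 (congrArg Subtype.val ((Submodule.mem_bot R).1 h1))

/-- The injective hull `E_R(M)` of a module `M`. -/
noncomputable def injectiveHull (R M : Type u) [CommRing R] [AddCommGroup M] [Module R M] :
    ModuleCat.{u} R :=
  (exists_isInjectiveHull R M).choose

/-- The inclusion of `M` into its injective hull. -/
noncomputable def toInjectiveHull (R M : Type u) [CommRing R] [AddCommGroup M] [Module R M] :
    M →ₗ[R] injectiveHull R M :=
  (exists_isInjectiveHull R M).choose_spec.choose

theorem isInjectiveHull_toInjectiveHull (R M : Type u) [CommRing R] [AddCommGroup M]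
    [Module R M] : IsInjectiveHull (toInjectiveHull R M) :=
  (exists_isInjectiveHull R M).choose_spec.choose_spec

section Characteristic

variable {R : Type*} [CommRing R] (p : ℕ) [Fact p.Prime] [CharP R p]

/-- A nontrivial algebra over a ring of prime characteristic `p` has characteristic `p`. -/
theorem charP_of_nontrivial_algebra (A : Type*) [CommRing A] [Nontrivial A] [Algebra R A] :
    CharP A p := by
  refine (CharP.charP_iff_prime_eq_zero Fact.out).2 ?_
  rw [← map_natCast (algebraMap R A), CharP.cast_eq_zero, map_zero]

instance charP_localizationAtPrime (P : Ideal R) [P.IsPrime] :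
    CharP (Localization.AtPrime P) p :=
  charP_of_nontrivial_algebra (R := R) p _

instance charP_residueField [IsLocalRing R] : CharP (IsLocalRing.ResidueField R) p :=
  charP_of_nontrivial_algebra (R := R) p _

end Characteristic

/-- The `R`-algebra `R^{(e)}`: it is the ring `R`, with `R`-algebra structure given by the `e`-th
iterate of Frobenius, that is `r • s = r ^ (p ^ e) * s`. -/
def FrobeniusAlgebra (R : Type u) (_p _e : ℕ) : Type u := R

instance (R : Type u) [CommRing R] (p e : ℕ) : CommRing (FrobeniusAlgebra R p e) :=
  inferInstanceAs (CommRing R)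

instance (R : Type u) [CommRing R] (p e : ℕ) [Fact p.Prime] [CharP R p] :
    Algebra R (FrobeniusAlgebra R p e) :=
  RingHom.toAlgebra (S := FrobeniusAlgebra R p e) (iterateFrobenius R p e)

/-- `R` is F-finite: `R^{(e)}` is a finitely generated `R`-module for all `e`. -/
def IsFFinite (R : Type u) [CommRing R] (p : ℕ) [Fact p.Prime] [CharP R p] : Prop :=
  ∀ e : ℕ, Module.Finite R (FrobeniusAlgebra R p e)

/-- `dim (R / P) = dim R` for all minimal primes `P` of `R`. -/
def IsEquidimensional (R : Type u) [CommRing R] : Prop :=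
  ∀ P ∈ minimalPrimes R, ringKrullDim (R ⧸ P) = ringKrullDim R

/-- All localizations of `R` at prime ideals are equidimensional. -/
def IsLocallyEquidimensional (R : Type u) [CommRing R] : Prop :=
  ∀ P : PrimeSpectrum R, IsEquidimensional (Localization.AtPrime P.asIdeal)

section Local

variable (R : Type u) [CommRing R] [IsLocalRing R] (p : ℕ) [Fact p.Prime] [CharP R p] (e : ℕ)

/-- The `R^{(e)}`-submodule `K_e` of `R^{(e)} ⊗_R E_R(k)`: the image of
`1 ⊗ ψ : R^{(e)} ⊗_R k → R^{(e)} ⊗_R E_R(k)`, where `ψ : k → E_R(k)` is the inclusion of the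
residue field into its injective hull. -/
noncomputable def frobeniusSocleImage :
    Submodule (FrobeniusAlgebra R p e)
      (FrobeniusAlgebra R p e ⊗[R] injectiveHull R (IsLocalRing.ResidueField R)) :=
  LinearMap.range ((toInjectiveHull R (IsLocalRing.ResidueField R)).baseChange
    (FrobeniusAlgebra R p e))

/-- The Krull dimension as a natural number (for a Noetherian local ring it is finite). -/
noncomputable def natDim (R : Type u) [CommRing R] : ℕ := ((ringKrullDim R).unbotD 0).toNat

/-- The `e`-th normalized Frobenius splitting number `s_e(R) = λ(K_e) / q ^ dim R` of a Noetherian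
local ring of characteristic `p`, where `q = p ^ e`. The length is over `R^{(e)}`, and it is
finite. -/
noncomputable def normalizedSplittingNumber : ℚ :=
  ((Module.length (FrobeniusAlgebra R p e) (frobeniusSocleImage R p e)).toNat : ℚ) /
    ((p : ℚ) ^ e) ^ natDim R

/-- `α(R) = log_p [k : k ^ p]`, where `k` is the residue field of `R`. -/
noncomputable def alphaInvariant : ℝ :=
  Real.logb p (Module.finrank (frobenius (IsLocalRing.ResidueField R) p).fieldRange
    (IsLocalRing.ResidueField R))

/-- The `e`-th Frobenius splitting number `a_e(R) = s_e(R) * q ^ (dim R + α(R))` of an F-finite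
Noetherian local ring, where `q = p ^ e`. -/
noncomputable def splittingNumber : ℝ :=
  (normalizedSplittingNumber R p e : ℝ) * ((p : ℝ) ^ e) ^ ((natDim R : ℝ) + alphaInvariant R p)

end Local

section Spec

variable {R : Type u} [CommRing R] (p : ℕ) [Fact p.Prime] [CharP R p] (e : ℕ)

/-- The function `s_e : Spec R → ℚ`, `P ↦ s_e(R_P)`. -/
noncomputable def normalizedSplittingNumberAt (P : PrimeSpectrum R) : ℚ :=
  normalizedSplittingNumber (Localization.AtPrime P.asIdeal) p e

/-- The function `a_e` on `Spec R`, `P ↦ a_e(R_P)`. -/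
noncomputable def splittingNumberAt (P : PrimeSpectrum R) : ℝ :=
  splittingNumber (Localization.AtPrime P.asIdeal) p e

end Spec

/-!
The proof reduces both splitting numbers to the rank of a bilinear pairing and to Kunz's formula for
the degree of the Frobenius map.

Let `A` be an F-finite Noetherian local ring with residue field `k`, let `M = A^{(e)}`, and let
`u = ψ(1)` be the socle generator of `E = E_A(k)`. The socle image `K_e` consists of the tensors
`x ⊗ u` with `x ∈ M`. Since `E` is injective and `M` is finitely presented, `M ⊗ E` embeds into
`Hom (Hom (M, A), E)`, so `x ⊗ u = 0` exactly if every linear form `f : M → A` maps `x` into the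
maximal ideal (`tmul_eq_zero_of_forall_dual`, `ker_tmul_eq_ker_residuePairing`). Hence `λ_A(K_e)` is
the rank over `k` of the pairing of `M` with its dual modulo the maximal ideal. As
`λ_A(K_e) = [k : k ^ q] * λ_{A^{(e)}}(K_e)`, this rank is `a_e(A)` (`splittingNumber_eq_finrank`).
No duality over the completion and no decomposition of `M` into free summands is needed.

The pairing commutes with localization: `a_e(P) ≥ n` holds exactly if some `n × n` determinant of
values `f i (x j)`, with `x j ∈ R^{(e)}` and `f i : R^{(e)} → R` linear, lies outside `P`
(`natCast_le_splittingNumberAt_iff`). This is an open condition on `P`.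

The two splitting numbers at `P` differ by the factor `γ(P) ^ e`, where
`γ(P) = p ^ dim R_P * [κ(P) : κ(P) ^ p]`. By Kunz's formula (`frobeniusDegree_fractionRing`),
applied to the quotient of `R_P` by a minimal prime, and by local equidimensionality, `γ(P)` equals
`[κ(p₀) : κ(p₀) ^ p]` for every minimal prime `p₀ ⊆ P`. So `γ` is constant on each of the finitely
many irreducible components of the spectrum, hence locally constant.

Kunz's formula itself reduces, along a chain of primes of maximal length, to a one-dimensional local
domain `D` with fraction field `K`. There one compares two computations of `λ_D(M / xM)` for
`M = D^{(1)}`: it is `rank M * λ(D / x)` with `rank M = [K : K ^ p]`, and it is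
`[k : k ^ p] * λ(D / x ^ p) = [k : k ^ p] * p * λ(D / x)`.
-/

open IsLocalRing

/-! ### Lengths over local algebras and the Frobenius algebra of a field -/

/-- If `B` is a local `A`-algebra and `S` is its simple module, every composition factor over `B` of
a `B`-module contributes the length of `S` over `A`. -/
theorem Module.length_eq_length_mul_length_of_isLocalRing (A B S : Type*) [CommRing A] [CommRing B]
    [IsLocalRing B] [Algebra A B] [AddCommGroup S] [Module B S] [IsSimpleModule B S] [Module A S]
    [IsScalarTower A B S] {N : Type*} [AddCommGroup N] [Module B N] (h : IsFiniteLength B N) :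
    ∀ [Module A N] [IsScalarTower A B N],
      Module.length A N = Module.length B N * Module.length A S := by
  induction h with
  | of_subsingleton =>
    intros
    simp
  | @of_simple_quotient M _ _ N' hs h' ih =>
    intros
    rw [Module.length_eq_add_of_exact N'.subtype N'.mkQ N'.injective_subtype
      N'.mkQ_surjective (LinearMap.exact_subtype_mkQ N'),
      Module.length_eq_add_of_exact (N'.subtype.restrictScalars A) (N'.mkQ.restrictScalars A)
        N'.injective_subtype N'.mkQ_surjective (LinearMap.exact_subtype_mkQ N'), ih,
      Module.length_eq_one B (M ⧸ N'), add_mul, one_mul]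
    congr 1
    obtain ⟨m, hm, ⟨f⟩⟩ := isSimpleModule_iff_quot_maximal.1 hs
    obtain ⟨m', hm', ⟨g⟩⟩ := isSimpleModule_iff_quot_maximal.1 ‹IsSimpleModule B S›
    obtain rfl : m = m' := by
      rw [IsLocalRing.eq_maximalIdeal hm, IsLocalRing.eq_maximalIdeal hm']
    exact ((f.trans g.symm).restrictScalars A).length_eq

/-- The degree `[k : k ^ p]` of a field `k` of characteristic `p`; it is `0` if the extension is
infinite. -/
noncomputable def frobeniusDegree (k : Type*) [Field k] (p : ℕ) [Fact p.Prime] [CharP k p] : ℕ :=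
  Module.finrank (frobenius k p).fieldRange k

theorem frobeniusDegree_congr {k k' : Type*} [Field k] [Field k'] (p : ℕ) [Fact p.Prime]
    [CharP k p] [CharP k' p] (f : k ≃+* k') : frobeniusDegree k p = frobeniusDegree k' p := by
  refine Algebra.finrank_eq_of_equiv_equiv
    (((frobenius k p).rangeRestrictFieldEquiv.symm.trans f).trans
      (frobenius k' p).rangeRestrictFieldEquiv) f ?_
  ext ⟨_, x, rfl⟩
  have h : (frobenius k p).rangeRestrictFieldEquiv.symm ⟨frobenius k p x, x, rfl⟩ = x :=
    (RingEquiv.symm_apply_eq _).2 rfl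
  simp only [RingHom.comp_apply, RingEquiv.toRingHom_eq_coe, RingHom.coe_coe,
    RingEquiv.coe_trans, Function.comp_apply, h]
  change frobenius k' p (f x) = f (frobenius k p x)
  simp [frobenius_def]

namespace FrobeniusAlgebra

section

variable (R : Type u) [CommRing R] (p e : ℕ)

/-- The identity map, as a ring isomorphism from `R` to `R^{(e)}`. -/
def of : R ≃+* FrobeniusAlgebra R p e := RingEquiv.refl R

variable {R p e} [Fact p.Prime] [CharP R p]

theorem smul_eq (r : R) (s : FrobeniusAlgebra R p e) : r • s = of R p e r ^ p ^ e * s := rfl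

instance [IsLocalRing R] : IsLocalRing (FrobeniusAlgebra R p e) := inferInstanceAs (IsLocalRing R)
instance [IsDomain R] : IsDomain (FrobeniusAlgebra R p e) := inferInstanceAs (IsDomain R)

end

section Field

variable (k : Type u) [Field k] (p e : ℕ)

/-- The field structure extends the ring structure of `k^{(e)}`. -/
noncomputable instance : Field (FrobeniusAlgebra k p e) :=
  ((of k p e).symm.toMulEquiv.isField (Field.toIsField k)).toField

variable [Fact p.Prime] [CharP k p]

theorem finrank_one : Module.finrank k (FrobeniusAlgebra k p 1) = frobeniusDegree k p := by
  refine Algebra.finrank_eq_of_equiv_equiv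
    (frobenius k p).rangeRestrictFieldEquiv (of k p 1).symm ?_
  ext x
  change x ^ p = x ^ p ^ 1
  rw [pow_one]

theorem finrank_eq_pow :
    Module.finrank k (FrobeniusAlgebra k p e) = frobeniusDegree k p ^ e := by
  rw [← finrank_one]
  induction e with
  | zero =>
    rw [pow_zero, ← Module.finrank_self k]
    refine LinearEquiv.finrank_eq (LinearEquiv.symm ?_)
    exact { (of k p 0) with
      map_smul' := fun r s => by
        change r * s = r ^ p ^ 0 * s
        rw [pow_zero, pow_one] }
  | succ e ih =>
    -- `k^{(e+1)}` is obtained from the extension `k → k^{(1)}` by renaming `k` as `k^{(e)}`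
    let : Algebra (FrobeniusAlgebra k p e) (FrobeniusAlgebra k p (e + 1)) :=
      RingHom.toAlgebra (R := FrobeniusAlgebra k p e) (S := FrobeniusAlgebra k p (e + 1))
        (iterateFrobenius k p 1)
    have : IsScalarTower k (FrobeniusAlgebra k p e) (FrobeniusAlgebra k p (e + 1)) :=
      IsScalarTower.of_algebraMap_eq fun x => by
        change x ^ p ^ (e + 1) = (x ^ p ^ e) ^ p ^ 1
        rw [← pow_mul, pow_one, pow_succ]
    rw [← Module.finrank_mul_finrank k (FrobeniusAlgebra k p e) (FrobeniusAlgebra k p (e + 1)), ih,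
      pow_succ]
    congr 1

end Field

end FrobeniusAlgebra

/-! ### Multiplication by an element of a one-dimensional domain -/

/-- If `g` is injective, the lengths of the cokernels of `f` and `g` add up to that of `g ∘ f`. -/
theorem Module.length_quotient_range_comp {R A B C : Type*} [CommRing R] [AddCommGroup A]
    [AddCommGroup B] [AddCommGroup C] [Module R A] [Module R B] [Module R C]
    (f : A →ₗ[R] B) (g : B →ₗ[R] C) (hg : Function.Injective g) :
    Module.length R (C ⧸ LinearMap.range (g ∘ₗ f)) =
      Module.length R (B ⧸ LinearMap.range f) + Module.length R (C ⧸ LinearMap.range g) := by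
  have h₁ : LinearMap.range f ≤ (LinearMap.range (g ∘ₗ f)).comap g := by
    rintro _ ⟨a, rfl⟩
    exact ⟨a, rfl⟩
  have h₂ : LinearMap.range (g ∘ₗ f) ≤ LinearMap.range g := LinearMap.range_comp_le_range f g
  refine Module.length_eq_add_of_exact (Submodule.mapQ _ _ g h₁) (Submodule.factor h₂) ?_
    (Submodule.factor_surjective h₂) ?_
  · rw [← LinearMap.ker_eq_bot, Submodule.ker_mapQ, LinearMap.range_comp,
      Submodule.comap_map_eq_of_injective hg, Submodule.mkQ_map_self]
  · rw [LinearMap.exact_iff]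
    ext y
    obtain ⟨c, rfl⟩ := Submodule.mkQ_surjective _ y
    simp only [LinearMap.mem_ker, LinearMap.mem_range]
    constructor
    · intro h
      obtain ⟨b, rfl⟩ : c ∈ LinearMap.range g := by simpa using h
      exact ⟨Submodule.Quotient.mk b, by simp⟩
    · rintro ⟨x, hx⟩
      obtain ⟨b, rfl⟩ := Submodule.mkQ_surjective _ x
      rw [← hx]
      simp

theorem Module.length_pi_quotient_range_lsmul {R : Type*} [CommRing R] (n : ℕ) (x : R) :
    Module.length R ((Fin n → R) ⧸ LinearMap.range (LinearMap.lsmul R (Fin n → R) x)) =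
      n * Ring.ord R x := by
  have h : LinearMap.range (LinearMap.lsmul R (Fin n → R) x) =
      Submodule.pi Set.univ fun _ => Ideal.span {x} := by
    ext v
    simp only [LinearMap.mem_range, LinearMap.lsmul_apply, Submodule.mem_pi, Set.mem_univ,
      true_imp_iff, Ideal.mem_span_singleton]
    constructor
    · rintro ⟨w, rfl⟩ i
      exact ⟨w i, rfl⟩
    · intro h
      choose w hw using h
      exact ⟨w, funext fun i => (hw i).symm⟩
  rw [h, (Submodule.quotientPi _).length_eq, Module.length_pi]
  simp [Ring.ord]

/-- A finitely generated torsion module over a one-dimensional Noetherian domain has finite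
length. -/
theorem Module.IsTorsion.length_ne_top {D T : Type*} [CommRing D] [IsDomain D] [IsNoetherianRing D]
    [Ring.KrullDimLE 1 D] [AddCommGroup T] [Module D T] [Module.Finite D T]
    (hT : Module.IsTorsion D T) : Module.length D T ≠ ⊤ := by
  obtain ⟨a, ha, ha₀⟩ := Submodule.annihilator_top_inter_nonZeroDivisors hT
  obtain ⟨n, f, hf⟩ := Module.Finite.exists_fin' D T
  have h : LinearMap.range (LinearMap.lsmul D (Fin n → D) a) ≤ LinearMap.ker f := by
    rintro _ ⟨v, rfl⟩
    simpa using Submodule.mem_annihilator.1 ha (f v) trivial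
  refine ne_top_of_le_ne_top ?_ (Module.length_le_of_surjective (Submodule.liftQ _ f h) ?_)
  · rw [Module.length_pi_quotient_range_lsmul]
    exact WithTop.mul_ne_top (ENat.natCast_ne_top n) (Ring.ord_ne_top ha₀)
  · intro y
    obtain ⟨v, rfl⟩ := hf y
    exact ⟨Submodule.Quotient.mk v, by simp⟩

/-- Over a one-dimensional Noetherian domain `D`, a finitely generated module `M` on which `x` acts
injectively satisfies `λ(M / xM) = rank M * λ(D / xD)`: a free submodule `L` of `M` of full rank has
`λ(L / xL) = λ(M / xM)`, because `λ(M / xL)` is `λ(M / L) + λ(L / xL)` as well as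
`λ(M / xM) + λ(xM / xL)`, where `xM / xL ≅ M / L` has finite length. -/
theorem Module.length_quotient_range_lsmul {D M : Type*} [CommRing D] [IsDomain D]
    [IsNoetherianRing D] [Ring.KrullDimLE 1 D] [AddCommGroup M] [Module D M] [Module.Finite D M]
    {x : D} (hxM : Function.Injective (LinearMap.lsmul D M x)) :
    Module.length D (M ⧸ LinearMap.range (LinearMap.lsmul D M x)) =
      Module.finrank D M * Ring.ord D x := by
  obtain ⟨v, hv⟩ := exists_linearIndependent_of_le_finrank (le_refl (Module.finrank D M))
  let ι : (Fin (Module.finrank D M) → D) →ₗ[D] M := Fintype.linearCombination D v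
  have hι : Function.Injective ι := linearIndependent_iff_injective_fintypeLinearCombination.1 hv
  have hT : Module.length D (M ⧸ LinearMap.range ι) ≠ ⊤ := by
    refine Module.IsTorsion.length_ne_top (Module.finrank_eq_zero_iff_isTorsion.1 ?_)
    have h₁ := Submodule.finrank_quotient_add_finrank (LinearMap.range ι)
    rw [LinearMap.finrank_range_of_inj hι, Module.finrank_fin_fun] at h₁
    omega
  have hcomm : LinearMap.lsmul D M x ∘ₗ ι = ι ∘ₗ LinearMap.lsmul D _ x := by
    ext i
    simp
  have h₁ := Module.length_quotient_range_comp ι (LinearMap.lsmul D M x) hxM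
  rw [hcomm, Module.length_quotient_range_comp _ _ hι,
    Module.length_pi_quotient_range_lsmul, add_comm] at h₁
  exact ((ENat.addLECancellable_of_ne_top hT).inj.1 h₁).symm

/-! ### Functoriality of the Frobenius algebra -/

namespace FrobeniusAlgebra

section Functoriality

variable (R S : Type u) [CommRing R] [CommRing S] [Algebra R S] (p e : ℕ) [Fact p.Prime]
  [CharP S p]

/-- An `R`-algebra `S` gives an `R^{(e)}`-algebra `S^{(e)}`. -/
abbrev mapAlgebra : Algebra (FrobeniusAlgebra R p e) (FrobeniusAlgebra S p e) :=
  RingHom.toAlgebra (R := FrobeniusAlgebra R p e) (S := FrobeniusAlgebra S p e) (algebraMap R S)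

/-- For an `R`-algebra `S`, the ring `S^{(e)}` as an `R`-algebra by restriction of scalars. -/
abbrev compAlgebra : Algebra R (FrobeniusAlgebra S p e) :=
  ((algebraMap S (FrobeniusAlgebra S p e)).comp (algebraMap R S)).toAlgebra

attribute [local instance] mapAlgebra compAlgebra

theorem isScalarTower_base : IsScalarTower R S (FrobeniusAlgebra S p e) :=
  IsScalarTower.of_algebraMap_eq' rfl

variable [CharP R p]

theorem isScalarTower_map : IsScalarTower R (FrobeniusAlgebra R p e) (FrobeniusAlgebra S p e) :=
  IsScalarTower.of_algebraMap_eq fun x => (map_pow (algebraMap R S) x (p ^ e)).symm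

attribute [local instance] isScalarTower_base isScalarTower_map

theorem finite_of_surjective (h : Function.Surjective (algebraMap R S))
    [Module.Finite R (FrobeniusAlgebra R p e)] : Module.Finite S (FrobeniusAlgebra S p e) := by
  have : Module.Finite R (FrobeniusAlgebra S p e) := Module.Finite.of_surjective
    (IsScalarTower.toAlgHom R (FrobeniusAlgebra R p e) (FrobeniusAlgebra S p e)).toLinearMap h
  exact Module.Finite.of_restrictScalars_finite R S _

/-- The functor `R ↦ R^{(e)}` commutes with localization: a fraction `x / s` is
`(s ^ (q - 1) * x) / s ^ q`, and `s ^ q` is the image of `s` in `R^{(e)}`. -/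
theorem isLocalizedModule (M : Submonoid R) [IsLocalization M S] :
    IsLocalizedModule M
      (IsScalarTower.toAlgHom R (FrobeniusAlgebra R p e) (FrobeniusAlgebra S p e)).toLinearMap where
  map_units s := by
    have h := ((IsLocalization.map_units S s).map (algebraMap S (FrobeniusAlgebra S p e))).map
      (algebraMap (FrobeniusAlgebra S p e) (Module.End (FrobeniusAlgebra S p e)
        (FrobeniusAlgebra S p e)))
    rw [Module.End.isUnit_iff] at h ⊢
    exact h
  surj y := by
    obtain ⟨⟨x, s⟩, hs⟩ := IsLocalization.surj M ((of S p e).symm y)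
    refine ⟨⟨of R p e ((s : R) ^ (p ^ e - 1) * x), s⟩, ?_⟩
    change (algebraMap R S s) ^ p ^ e * (of S p e).symm y = algebraMap R S (s ^ (p ^ e - 1) * x)
    obtain ⟨n, hn⟩ : ∃ n, p ^ e = n + 1 :=
      Nat.exists_eq_succ_of_ne_zero (pow_ne_zero e (Fact.out : p.Prime).ne_zero)
    rw [hn, Nat.add_sub_cancel, pow_succ, mul_assoc, mul_comm (algebraMap R S s), hs, map_mul,
      map_pow]
  exists_of_eq {x₁ x₂} h := by
    have h' : algebraMap R S ((of R p e).symm x₁) = algebraMap R S ((of R p e).symm x₂) := h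
    obtain ⟨c, hc⟩ := IsLocalization.exists_of_eq (M := M) h'
    refine ⟨c, ?_⟩
    change (c : R) ^ p ^ e * (of R p e).symm x₁ = (c : R) ^ p ^ e * (of R p e).symm x₂
    obtain ⟨n, hn⟩ : ∃ n, p ^ e = n + 1 :=
      Nat.exists_eq_succ_of_ne_zero (pow_ne_zero e (Fact.out : p.Prime).ne_zero)
    rw [hn, pow_succ, mul_assoc, hc, mul_assoc]

theorem finite_of_isLocalization (M : Submonoid R) [IsLocalization M S]
    [Module.Finite R (FrobeniusAlgebra R p e)] : Module.Finite S (FrobeniusAlgebra S p e) :=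
  have := isLocalizedModule R S p e M
  Module.Finite.of_isLocalizedModule M
    (IsScalarTower.toAlgHom R (FrobeniusAlgebra R p e) (FrobeniusAlgebra S p e)).toLinearMap

end Functoriality

section Length

attribute [local instance] mapAlgebra compAlgebra isScalarTower_base isScalarTower_map

theorem isFractionRing (D K : Type u) (p e : ℕ) [CommRing D] [Field K] [Algebra D K]
    [IsFractionRing D K] :
    IsFractionRing (FrobeniusAlgebra D p e) (FrobeniusAlgebra K p e) where
  map_units y := IsLocalization.map_units (M := nonZeroDivisors D) K y
  surj z := IsLocalization.surj (M := nonZeroDivisors D) (S := K) z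
  exists_of_eq {x y} h :=
    IsLocalization.exists_of_eq (M := nonZeroDivisors D) (S := K) (x := x) (y := y) h

/-- For an F-finite local ring `A` with residue field `k`, lengths over `A` and over `A^{(e)}`
differ by the factor `[k : k ^ q] = [k : k ^ p] ^ e`. -/
theorem length_eq_length_mul_frobeniusDegree_pow {A : Type u} [CommRing A] [IsLocalRing A] (p e : ℕ)
    [Fact p.Prime] [CharP A p] [Module.Finite A (FrobeniusAlgebra A p e)] {N : Type*}
    [AddCommGroup N] [Module (FrobeniusAlgebra A p e) N] [Module A N]
    [IsScalarTower A (FrobeniusAlgebra A p e) N] (hN : IsFiniteLength (FrobeniusAlgebra A p e) N) :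
    Module.length A N = Module.length (FrobeniusAlgebra A p e) N *
      (frobeniusDegree (ResidueField A) p ^ e : ℕ) := by
  have : Module.Finite (ResidueField A) (FrobeniusAlgebra (ResidueField A) p e) :=
    finite_of_surjective A (ResidueField A) p e residue_surjective
  have : IsSimpleModule (FrobeniusAlgebra A p e) (FrobeniusAlgebra (ResidueField A) p e) := by
    refine isSimpleModule_iff_toSpanSingleton_surjective.2 ⟨inferInstance, fun x hx y => ?_⟩
    obtain ⟨a, ha⟩ := residue_surjective ((of (ResidueField A) p e).symm (y / x))
    refine ⟨of A p e a, ?_⟩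
    change of (ResidueField A) p e (residue A a) * x = y
    rw [ha, RingEquiv.apply_symm_apply, div_mul_cancel₀ _ hx]
  rw [Module.length_eq_length_mul_length_of_isLocalRing A (FrobeniusAlgebra A p e)
    (FrobeniusAlgebra (ResidueField A) p e) hN,
    Module.length_eq_of_surjective (R := ResidueField A) (S := A)
      (M := FrobeniusAlgebra (ResidueField A) p e) residue_surjective,
    Module.length_eq_finrank, finrank_eq_pow]

end Length

end FrobeniusAlgebra

theorem IsFFinite.of_surjective {R S : Type u} [CommRing R] [CommRing S] [Algebra R S] {p : ℕ}
    [Fact p.Prime] [CharP R p] [CharP S p] (hR : IsFFinite R p)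
    (h : Function.Surjective (algebraMap R S)) : IsFFinite S p := fun e =>
  have := hR e
  FrobeniusAlgebra.finite_of_surjective R S p e h

theorem IsFFinite.of_isLocalization {R S : Type u} [CommRing R] [CommRing S] [Algebra R S] {p : ℕ}
    [Fact p.Prime] [CharP R p] [CharP S p] (hR : IsFFinite R p) (M : Submonoid R)
    [IsLocalization M S] : IsFFinite S p := fun e =>
  have := hR e
  FrobeniusAlgebra.finite_of_isLocalization R S p e M

/-! ### Kunz's formula -/

section DimensionOne

attribute [local instance] FrobeniusAlgebra.mapAlgebra FrobeniusAlgebra.compAlgebra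
  FrobeniusAlgebra.isScalarTower_base FrobeniusAlgebra.isScalarTower_map

/-- The one-dimensional case of Kunz's formula: comparing `λ(M / xM)` for `M = D^{(1)}`, computed
once as `[K : K ^ p] * λ(D / x)` and once as `[k : k ^ p] * λ(D / x ^ p)`. -/
theorem frobeniusDegree_fractionRing_of_krullDimLE_one {D K : Type u} [CommRing D] [IsDomain D]
    [IsNoetherianRing D] [IsLocalRing D] [Ring.KrullDimLE 1 D] (hD : ¬ IsField D) [Field K]
    [Algebra D K] [IsFractionRing D K] {p : ℕ} [Fact p.Prime] [CharP D p] [CharP K p]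
    (hF : IsFFinite D p) :
    frobeniusDegree K p = p * frobeniusDegree (ResidueField D) p := by
  obtain ⟨x, hx, hx₀⟩ : ∃ x ∈ maximalIdeal D, x ≠ 0 := by
    by_contra! h
    exact hD (isField_iff_maximalIdeal_eq.2 ((Submodule.eq_bot_iff _).2 h))
  have := hF 1
  have hx₁ := mem_nonZeroDivisors_of_ne_zero hx₀
  let M := FrobeniusAlgebra D p 1
  let y : M := FrobeniusAlgebra.of D p 1 x
  -- ranks do not change under passage to fraction fields, and `K^{(1)}` is that of `M`
  have hrank : Module.finrank D M = frobeniusDegree K p := by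
    have := FrobeniusAlgebra.isFractionRing D K p 1
    rw [← FrobeniusAlgebra.finrank_one]
    exact (IsFractionRing.finrank_eq D K (FrobeniusAlgebra D p 1) (FrobeniusAlgebra K p 1)).symm
  -- over `M`, the submodule `x • M` is the ideal generated by `y ^ p`
  have hxy : ∀ z : M, x • z = y ^ p * z := fun z => by
    rw [FrobeniusAlgebra.smul_eq, pow_one]
  have hy : y ≠ 0 := hx₀
  have hinj : Function.Injective (LinearMap.lsmul D M x) := by
    intro z w h
    simp only [LinearMap.lsmul_apply, hxy] at h
    exact mul_left_cancel₀ (pow_ne_zero p hy) h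
  have h₁ := Module.length_quotient_range_lsmul hinj
  rw [hrank] at h₁
  have hord : Module.length M (M ⧸ Ideal.span {y ^ p}) = p * Ring.ord D x := by
    rw [← nsmul_eq_mul, ← Ring.ord_pow hx₁ p]
    rfl
  have hfl : IsFiniteLength M (M ⧸ Ideal.span {y ^ p}) := by
    rw [← Module.length_ne_top_iff, hord]
    exact WithTop.mul_ne_top (ENat.natCast_ne_top p) (Ring.ord_ne_top hx₁)
  have h₂ := FrobeniusAlgebra.length_eq_length_mul_frobeniusDegree_pow p 1 hfl
  have hspan : LinearMap.range (LinearMap.lsmul D M x) =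
      (Ideal.span {y ^ p} : Ideal M).restrictScalars D := by
    ext z
    simp only [LinearMap.mem_range, LinearMap.lsmul_apply, hxy, Submodule.restrictScalars_mem,
      Ideal.mem_span_singleton]
    exact ⟨fun ⟨w, hw⟩ => ⟨w, hw.symm⟩, fun ⟨w, hw⟩ => ⟨w, hw.symm⟩⟩
  have h₃ : Module.length D (M ⧸ LinearMap.range (LinearMap.lsmul D M x)) =
      Module.length D (M ⧸ (Ideal.span {y ^ p} : Ideal M)) := by
    rw [hspan]
    rfl
  rw [← h₃, h₁, hord, pow_one] at h₂
  obtain ⟨n, hn⟩ := ENat.ne_top_iff_exists.1 (Ring.ord_ne_top hx₁)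
  have hn₀ : n ≠ 0 := by
    rintro rfl
    have : Subsingleton (D ⧸ Ideal.span {x}) :=
      Module.length_eq_zero_iff.1 (by rw [← Ring.ord, ← hn]; rfl)
    rw [Ideal.Quotient.subsingleton_iff, Ideal.span_singleton_eq_top] at this
    exact (mem_maximalIdeal x).1 hx this
  rw [← hn] at h₂
  norm_cast at h₂
  exact Nat.eq_of_mul_eq_mul_right (Nat.pos_of_ne_zero hn₀) (by rw [h₂]; ring)

end DimensionOne

/-- A ring of finite positive dimension `n + 1` has a prime ideal of height one whose quotient has
dimension `n`: the second prime of a chain of maximal length. -/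
theorem exists_isPrime_height_eq_one {D : Type u} [CommRing D] {n : ℕ}
    (hn : ringKrullDim D = (n + 1 : ℕ)) :
    ∃ q : Ideal D, q.IsPrime ∧ q.height = 1 ∧ ringKrullDim (D ⧸ q) = n := by
  obtain ⟨l, hl⟩ := Order.le_krullDim_iff.1 hn.ge
  let i : Fin (l.length + 1) := ⟨1, by omega⟩
  let q := l i
  have : Nonempty (PrimeSpectrum D) := ⟨q⟩
  have h₁ : (1 : ℕ∞) ≤ Order.height q := Order.index_le_height l i
  have h₂ : (n : ℕ∞) ≤ Order.coheight q := by
    have h := Order.rev_index_le_coheight l i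
    have h' : ((i.rev : Fin _) : ℕ) = n := by simp [i, Fin.rev, hl]
    rwa [h'] at h
  have h₃ : Order.height q + Order.coheight q ≤ (n + 1 : ℕ) := by
    rw [← WithBot.coe_le_coe]
    refine le_trans ?_ hn.le
    rw [ringKrullDim, Order.krullDim_eq_iSup_height_add_coheight_of_nonempty, WithBot.coe_le_coe]
    exact le_iSup (fun a => Order.height a + Order.coheight a) q
  have ht : Order.height q ≠ ⊤ := fun h => by rw [h, top_add] at h₃; simp at h₃
  have ht' : Order.coheight q ≠ ⊤ := fun h => by rw [h, add_top] at h₃; simp at h₃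
  refine ⟨q.asIdeal, q.2, ?_, ?_⟩
  · rw [PrimeSpectrum.height_eq_orderHeight]
    lift Order.height q to ℕ using ht with a
    lift Order.coheight q to ℕ using ht' with b
    norm_cast at *
    omega
  · have h₄ : PrimeSpectrum.zeroLocus (q.asIdeal : Set D) = Set.Ici q := by
      ext r
      simp [PrimeSpectrum.mem_zeroLocus, PrimeSpectrum.asIdeal_le_asIdeal]
    rw [ringKrullDim_quotient, h₄, ← Order.coheight_eq_krullDim_Ici]
    lift Order.height q to ℕ using ht with a
    lift Order.coheight q to ℕ using ht' with b
    norm_cast at *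
    omega

/-- The residue field of a quotient of a local ring is the residue field of the ring. -/
noncomputable def IsLocalRing.ResidueField.equivOfSurjective {A B : Type*} [CommRing A] [CommRing B]
    [IsLocalRing A] [IsLocalRing B] (f : A →+* B) [IsLocalHom f] (hf : Function.Surjective f) :
    ResidueField A ≃+* ResidueField B :=
  RingEquiv.ofBijective (ResidueField.map f) ⟨RingHom.injective _, fun y => by
    obtain ⟨b, rfl⟩ := residue_surjective y
    obtain ⟨a, rfl⟩ := hf b
    exact ⟨residue A a, ResidueField.map_residue f a⟩⟩

/-- Kunz's formula `[K : K ^ p] = p ^ dim D * [k : k ^ p]` for an F-finite Noetherian local domain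
`D` with fraction field `K` and residue field `k`. The induction splits off a prime `q` of height
one with `dim (D / q) = dim D - 1`: the field `κ(q)` is the residue field of the one-dimensional
ring `D_q` and the fraction field of `D / q`. -/
theorem frobeniusDegree_fractionRing {D K : Type u} [CommRing D] [IsDomain D]
    [IsNoetherianRing D] [IsLocalRing D] [Field K] [Algebra D K] [IsFractionRing D K] {p : ℕ}
    [Fact p.Prime] [CharP D p] [CharP K p] (hF : IsFFinite D p) {n : ℕ}
    (hn : ringKrullDim D = n) :
    frobeniusDegree K p = p ^ n * frobeniusDegree (ResidueField D) p := by
  induction n generalizing D K with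
  | zero =>
    have : Ring.KrullDimLE 0 D := Ring.krullDimLE_iff.2 hn.le
    have hD : IsField D := Ring.KrullDimLE.isField_of_isDomain
    have h₁ : Function.Bijective (algebraMap D K) :=
      ⟨IsFractionRing.injective D K, IsFractionRing.surjective_iff_isField.2 hD⟩
    have h₂ : Function.Bijective (residue D) :=
      ⟨(RingHom.injective_iff_ker_eq_bot _).2
        (by rw [ker_residue, isField_iff_maximalIdeal_eq.1 hD]), residue_surjective⟩
    rw [pow_zero, one_mul]
    exact frobeniusDegree_congr p
      ((RingEquiv.ofBijective _ h₁).symm.trans (RingEquiv.ofBijective _ h₂))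
  | succ n ih =>
    obtain ⟨q, hq, hq₁, hqn⟩ := exists_isPrime_height_eq_one hn
    have : CharP (D ⧸ q) p := charP_of_nontrivial_algebra (R := D) p _
    have : CharP (FractionRing D) p := charP_of_nontrivial_algebra (R := D) p _
    have : IsLocalRing (D ⧸ q) := .of_surjective' _ Ideal.Quotient.mk_surjective
    have : IsLocalHom (Ideal.Quotient.mk q) := .of_surjective _ Ideal.Quotient.mk_surjective
    have hdim : ringKrullDim (Localization.AtPrime q) = 1 := by
      rw [IsLocalization.AtPrime.ringKrullDim_eq_height q, hq₁]
      rfl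
    have : Ring.KrullDimLE 1 (Localization.AtPrime q) := Ring.krullDimLE_iff.2 hdim.le
    have hfield : ¬ IsField (Localization.AtPrime q) := fun h => by
      rw [ringKrullDim_eq_zero_of_isField h] at hdim
      exact zero_ne_one hdim
    have : IsFractionRing (Localization.AtPrime q) (FractionRing D) :=
      IsFractionRing.isFractionRing_of_isDomain_of_isLocalization q.primeCompl _ _
    have h₁ : frobeniusDegree (FractionRing D) p = p * frobeniusDegree q.ResidueField p :=
      frobeniusDegree_fractionRing_of_krullDimLE_one hfield (hF.of_isLocalization q.primeCompl)
    have h₂ : frobeniusDegree q.ResidueField p = _ :=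
      ih (D := D ⧸ q) (hF.of_surjective Ideal.Quotient.mk_surjective) hqn
    rw [frobeniusDegree_congr p (FractionRing.algEquiv D K).symm.toRingEquiv, h₁, h₂,
      frobeniusDegree_congr p (ResidueField.equivOfSurjective (Ideal.Quotient.mk q)
        Ideal.Quotient.mk_surjective), pow_succ]
    ring

/-! ### Pure tensors with an injective module -/

/-- If `E` is injective and `M` is finitely presented, the canonical map
`M ⊗ E → Hom (Hom (M, R), E)` is injective; here for pure tensors over a Noetherian ring. Dualizing
a presentation of `M` twice expresses `x ⊗ u` through the relations of `M`. -/
theorem tmul_eq_zero_of_forall_dual {R M E : Type u} [CommRing R] [IsNoetherianRing R]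
    [AddCommGroup M] [Module R M] [Module.Finite R M] [AddCommGroup E] [Module R E]
    (hE : Module.Injective R E) {x : M} {u : E} (h : ∀ f : M →ₗ[R] R, f x • u = 0) :
    x ⊗ₜ[R] u = 0 := by
  obtain ⟨t, π, hπ⟩ := Module.Finite.exists_fin' R M
  obtain ⟨s, τ, hτ⟩ := Module.Finite.exists_fin' R (LinearMap.ker π)
  let l : Fin s → Fin t → R := fun j => (τ (Pi.single j 1) : Fin t → R)
  have hl : ∀ j, π (l j) = 0 := fun j => (τ (Pi.single j 1)).2
  obtain ⟨v, rfl⟩ := hπ x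
  -- the transpose of the relation matrix; its kernel is the dual of `M`
  let T : (Fin t → R) →ₗ[R] (Fin s → R) := LinearMap.pi fun j => Fintype.linearCombination R (l j)
  let ζ : (Fin t → R) →ₗ[R] E := (Fintype.linearCombination R v).smulRight u
  have hT : LinearMap.ker T ≤ LinearMap.ker ζ := by
    intro c hc
    have hle : LinearMap.ker π ≤ LinearMap.ker (Fintype.linearCombination R c) := by
      intro w hw
      obtain ⟨d, hd⟩ := hτ ⟨w, hw⟩
      have h₁ : (Fintype.linearCombination R c) ∘ₗ (LinearMap.ker π).subtype ∘ₗ τ = 0 := by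
        ext j
        have := congrFun (LinearMap.mem_ker.1 hc) j
        simp only [T, LinearMap.pi_apply, Fintype.linearCombination_apply, smul_eq_mul,
          Pi.zero_apply] at this
        simp only [LinearMap.comp_apply, LinearMap.single_apply, Submodule.subtype_apply,
          Fintype.linearCombination_apply, smul_eq_mul, LinearMap.zero_apply]
        rw [← this]
        exact Finset.sum_congr rfl fun i _ => mul_comm _ _
      have h₂ := LinearMap.congr_fun h₁ d
      simpa [hd] using h₂
    let f : M →ₗ[R] R := ((LinearMap.ker π).liftQ _ hle) ∘ₗ
      (π.quotKerEquivOfSurjective hπ).symm.toLinearMap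
    have hf : f (π v) = Fintype.linearCombination R c v := by
      have : (π.quotKerEquivOfSurjective hπ).symm (π v) = Submodule.Quotient.mk v :=
        (LinearEquiv.symm_apply_eq _).2 rfl
      simp [f, this]
    have h₃ := h f
    rw [hf] at h₃
    simp only [ζ, LinearMap.mem_ker, LinearMap.smulRight_apply]
    rw [← h₃]
    congr 1
    simp only [Fintype.linearCombination_apply, smul_eq_mul]
    exact Finset.sum_congr rfl fun i _ => mul_comm _ _
  obtain ⟨w, hw⟩ := hE.out ((LinearMap.ker T).liftQ T le_rfl)
    (LinearMap.ker_eq_bot.1 (Submodule.ker_liftQ_eq_bot _ _ _ le_rfl))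
    ((LinearMap.ker T).liftQ ζ hT)
  have hvu : ∀ i, v i • u = ∑ j, l j i • w (Pi.single j 1) := by
    intro i
    have h₁ := hw (Submodule.Quotient.mk (Pi.single i 1))
    rw [Submodule.liftQ_apply, Submodule.liftQ_apply] at h₁
    have h₂ : T (Pi.single i 1) = fun j => l j i := by
      ext j
      simp [T, Fintype.linearCombination_apply_single]
    have h₃ : ζ (Pi.single i 1) = v i • u := by
      simp [ζ, Fintype.linearCombination_apply_single]
    rw [← h₃, ← h₁, h₂]
    conv_lhs => rw [← Finset.univ_sum_single (fun j => l j i), map_sum]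
    refine Finset.sum_congr rfl fun j _ => ?_
    rw [← map_smul, ← Pi.single_smul, smul_eq_mul, mul_one]
  have hπv : ∀ c : Fin t → R, π c = ∑ i, c i • π (Pi.single i 1) := fun c => by
    conv_lhs => rw [← Finset.univ_sum_single c, map_sum]
    refine Finset.sum_congr rfl fun j _ => ?_
    rw [← map_smul, ← Pi.single_smul, smul_eq_mul, mul_one]
  rw [hπv v, TensorProduct.sum_tmul]
  simp_rw [TensorProduct.smul_tmul, hvu, TensorProduct.tmul_sum, ← TensorProduct.smul_tmul]
  rw [Finset.sum_comm]
  refine Finset.sum_eq_zero fun j _ => ?_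
  rw [← TensorProduct.sum_tmul, ← hπv, hl, TensorProduct.zero_tmul]

/-- Functions `v j : X → k` are linearly independent exactly if some square matrix of their values
is invertible. -/
theorem linearIndependent_iff_exists_det_ne_zero {k X : Type*} [Field k] {n : ℕ}
    {v : Fin n → X → k} :
    LinearIndependent k v ↔ ∃ f : Fin n → X, (Matrix.of fun i j => v j (f i)).det ≠ 0 := by
  constructor
  · intro hv
    let s : Set (Fin n → k) := Set.range fun f j => v j f
    have hs : Submodule.span k s = ⊤ := by
      by_contra hs
      obtain ⟨g, hg₀, hg⟩ := Submodule.exists_le_ker_of_lt_top _ (lt_top_iff_ne_top.2 hs)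
      apply hg₀
      have h₁ : ∑ j, g (Pi.single j 1) • v j = 0 := by
        ext f
        have h₂ : g (fun j => v j f) = 0 := hg (Submodule.subset_span ⟨f, rfl⟩)
        rw [← Finset.univ_sum_single (fun j => v j f), map_sum] at h₂
        rw [Finset.sum_apply, Pi.zero_apply, ← h₂]
        refine Finset.sum_congr rfl fun j _ => ?_
        rw [Pi.smul_apply, smul_eq_mul, mul_comm, ← smul_eq_mul, ← map_smul, ← Pi.single_smul,
          smul_eq_mul, mul_one]
      ext j
      simpa using Fintype.linearIndependent_iff.1 hv _ h₁ j
    obtain ⟨g, hg, -, hgi⟩ := Submodule.exists_fun_fin_finrank_span_eq k s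
    have hn : Module.finrank k (Submodule.span k s) = n := by rw [hs]; simp
    choose f hf using hg
    refine ⟨fun i => f (Fin.cast hn.symm i), ?_⟩
    rw [← isUnit_iff_ne_zero, ← Matrix.isUnit_iff_isUnit_det,
      ← Matrix.linearIndependent_rows_iff_isUnit]
    have h₃ : (Matrix.of fun i j => v j (f (Fin.cast hn.symm i))).row =
        g ∘ Fin.cast hn.symm := by
      ext i j
      exact congrFun (hf (Fin.cast hn.symm i)) j
    rw [h₃]
    exact hgi.comp _ (Fin.cast_injective _)
  · rintro ⟨f, hf⟩
    rw [← isUnit_iff_ne_zero, ← Matrix.isUnit_iff_isUnit_det,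
      ← Matrix.linearIndependent_cols_iff_isUnit] at hf
    exact LinearIndependent.of_comp (LinearMap.funLeft k k f) hf

/-! ### The socle image and the residue pairing -/

section Socle

variable {A M : Type u} [CommRing A] [IsLocalRing A] [AddCommGroup M] [Module A M]

/-- The pairing of a module `M` with its dual, reduced modulo the maximal ideal. -/
noncomputable def residuePairing (A M : Type u) [CommRing A] [IsLocalRing A] [AddCommGroup M]
    [Module A M] : M →ₗ[A] ((M →ₗ[A] A) → ResidueField A) :=
  LinearMap.pi fun f => (Algebra.linearMap A (ResidueField A)) ∘ₗ f

theorem residuePairing_apply (x : M) (f : M →ₗ[A] A) : residuePairing A M x f = residue A (f x) :=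
  rfl

/-- `x ⊗ ψ(1)` vanishes in `M ⊗ E(k)` exactly if `f x` lies in the maximal ideal for all
`f : M → A`. -/
theorem ker_tmul_eq_ker_residuePairing [IsNoetherianRing A] [Module.Finite A M] {E : Type u}
    [AddCommGroup E] [Module A E] {ψ : ResidueField A →ₗ[A] E} (hψ : IsInjectiveHull ψ) :
    LinearMap.ker ((TensorProduct.mk A M E).flip (ψ 1)) = LinearMap.ker (residuePairing A M) := by
  have key : ∀ a : A, a • ψ 1 = 0 ↔ residue A a = 0 := fun a => by
    rw [← map_smul, Algebra.smul_def, mul_one, map_eq_zero_iff ψ hψ.injective]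
    rfl
  ext x
  simp only [LinearMap.mem_ker, LinearMap.flip_apply, TensorProduct.mk_apply]
  constructor
  · intro h
    ext f
    have h₁ := congrArg (TensorProduct.lid A E ∘ f.rTensor E) h
    simp only [Function.comp_apply, LinearMap.rTensor_tmul, TensorProduct.lid_tmul, map_zero] at h₁
    rw [residuePairing_apply, (key _).1 h₁, Pi.zero_apply]
  · intro h
    exact tmul_eq_zero_of_forall_dual hψ.injective_module fun f => (key _).2 (congrFun h f)

/-- The image of the residue pairing, as a vector space over the residue field. -/
noncomputable def residuePairingRange (A M : Type u) [CommRing A] [IsLocalRing A] [AddCommGroup M]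
    [Module A M] : Submodule (ResidueField A) ((M →ₗ[A] A) → ResidueField A) where
  __ := LinearMap.range (residuePairing A M)
  smul_mem' c v hv := by
    obtain ⟨a, rfl⟩ := residue_surjective c
    exact (LinearMap.range (residuePairing A M)).smul_mem a hv

instance [Module.Finite A M] : Module.Finite (ResidueField A) (residuePairingRange A M) :=
  have : Module.Finite A (residuePairingRange A M) :=
    inferInstanceAs (Module.Finite A (LinearMap.range (residuePairing A M)))
  Module.Finite.of_restrictScalars_finite A _ _

/-- The rank of the residue pairing is at least `n` exactly if some `n × n` matrix of values of
linear forms is invertible over `A`. -/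
theorem le_finrank_residuePairingRange_iff [Module.Finite A M] (n : ℕ) :
    n ≤ Module.finrank (ResidueField A) (residuePairingRange A M) ↔
      ∃ (x : Fin n → M) (f : Fin n → M →ₗ[A] A),
        IsUnit (Matrix.of fun i j => f i (x j)).det := by
  have key : ∀ (x : Fin n → M) (f : Fin n → M →ₗ[A] A),
      (Matrix.of fun i j => residuePairing A M (x j) (f i)).det ≠ 0 ↔
        IsUnit (Matrix.of fun i j => f i (x j)).det := fun x f => by
    rw [← residue_ne_zero_iff_isUnit, RingHom.map_det]
    rfl
  simp_rw [← key, ← linearIndependent_iff_exists_det_ne_zero]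
  constructor
  · intro h
    obtain ⟨w, hw⟩ := exists_linearIndependent_of_le_finrank h
    choose x hx using fun j => (w j).2
    refine ⟨x, ?_⟩
    have h₁ := hw.map' (residuePairingRange A M).subtype (Submodule.ker_subtype _)
    have h₂ : (fun j => residuePairing A M (x j)) = (residuePairingRange A M).subtype ∘ w :=
      funext hx
    rw [h₂]
    exact h₁
  · rintro ⟨x, hx⟩
    let w : Fin n → residuePairingRange A M := fun j => ⟨residuePairing A M (x j), x j, rfl⟩
    have h₁ : LinearIndependent (ResidueField A) w :=
      LinearIndependent.of_comp (residuePairingRange A M).subtype hx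
    simpa using h₁.fintype_card_le_finrank

/-- The socle image of a finite `A`-algebra `B` and the image of the residue pairing of `B` are both
the quotient of `B` by the same kernel. -/
theorem length_range_baseChange_eq_finrank [IsNoetherianRing A] {B E : Type u} [CommRing B]
    [Algebra A B] [Module.Finite A B] [AddCommGroup E] [Module A E] {ψ : ResidueField A →ₗ[A] E}
    (hψ : IsInjectiveHull ψ) :
    Module.length A (LinearMap.range (ψ.baseChange B)) =
      Module.finrank (ResidueField A) (residuePairingRange A B) := by
  let ρ : B →ₗ[A] B ⊗[A] E := (TensorProduct.mk A B E).flip (ψ 1)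
  have hρ : (LinearMap.range (ψ.baseChange B)).restrictScalars A = LinearMap.range ρ := by
    apply le_antisymm
    · rintro _ ⟨z, rfl⟩
      induction z with
      | zero => simp
      | add z w hz hw =>
        rw [map_add]
        exact add_mem hz hw
      | tmul b c =>
        obtain ⟨a, rfl⟩ := residue_surjective c
        refine ⟨a • b, ?_⟩
        rw [LinearMap.baseChange_tmul, LinearMap.flip_apply, TensorProduct.mk_apply,
          TensorProduct.smul_tmul, ← map_smul, Algebra.smul_def, mul_one]
        rfl
    · rintro _ ⟨b, rfl⟩
      exact ⟨b ⊗ₜ 1, LinearMap.baseChange_tmul _ _ _⟩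
  have h₁ : Module.length A (LinearMap.range (ψ.baseChange B)) =
      Module.length A (LinearMap.range ρ) := by
    rw [← hρ]
    rfl
  have h₂ : Module.length A (LinearMap.range ρ) =
      Module.length A (LinearMap.range (residuePairing A B)) :=
    ((ρ.quotKerEquivRange.symm.trans (Submodule.quotEquivOfEq _ _
      (ker_tmul_eq_ker_residuePairing hψ))).trans
        (residuePairing A B).quotKerEquivRange).length_eq
  have h₃ : Module.length A (LinearMap.range (residuePairing A B)) =
      Module.length A (residuePairingRange A B) := rfl
  rw [h₁, h₂, h₃, Module.length_eq_of_surjective (R := ResidueField A) residue_surjective,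
    Module.length_eq_finrank]

end Socle

section SplittingNumber

variable {A : Type u} [CommRing A] [IsLocalRing A] {p : ℕ} [Fact p.Prime] [CharP A p]

theorem frobeniusDegree_residueField_pos (hF : IsFFinite A p) :
    0 < frobeniusDegree (ResidueField A) p := by
  have : Module.Finite (ResidueField A) (FrobeniusAlgebra (ResidueField A) p 1) :=
    hF.of_surjective residue_surjective 1
  rw [← FrobeniusAlgebra.finrank_one]
  exact Module.finrank_pos

theorem splittingNumber_eq_mul (hF : IsFFinite A p) (e : ℕ) :
    splittingNumber A p e = (((p : ℝ) ^ natDim A * frobeniusDegree (ResidueField A) p) ^ e) *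
      normalizedSplittingNumber A p e := by
  have hp : (0 : ℝ) < p := Nat.cast_pos.2 (Fact.out : p.Prime).pos
  have hp₁ : (p : ℝ) ≠ 1 := Nat.cast_ne_one.2 (Fact.out : p.Prime).ne_one
  have hd : (0 : ℝ) < frobeniusDegree (ResidueField A) p :=
    Nat.cast_pos.2 (frobeniusDegree_residueField_pos hF)
  rw [splittingNumber, mul_comm, ← Real.rpow_natCast, ← Real.rpow_mul hp.le, mul_comm (e : ℝ),
    Real.rpow_mul hp.le, Real.rpow_add hp, Real.rpow_natCast, Real.rpow_natCast, alphaInvariant]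
  change (_ * (p : ℝ) ^ Real.logb p (frobeniusDegree (ResidueField A) p)) ^ e * _ = _
  rw [Real.rpow_logb hp hp₁ hd]

theorem length_le_length_of_isScalarTower (A B N : Type*) [CommRing A] [CommRing B] [Algebra A B]
    [AddCommGroup N] [Module A N] [Module B N] [IsScalarTower A B N] :
    Module.length B N ≤ Module.length A N := by
  have h := Submodule.length_le_length_restrictScalars A (⊤ : Submodule B N)
  rwa [Module.length_top, Submodule.restrictScalars_top, Module.length_top] at h

theorem length_frobeniusSocleImage [IsNoetherianRing A] (hF : IsFFinite A p) (e : ℕ) :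
    Module.length A (frobeniusSocleImage A p e) = Module.finrank (ResidueField A)
      (residuePairingRange A (FrobeniusAlgebra A p e)) :=
  have := hF e
  length_range_baseChange_eq_finrank (isInjectiveHull_toInjectiveHull A (ResidueField A))

theorem isFiniteLength_frobeniusSocleImage [IsNoetherianRing A] (hF : IsFFinite A p) (e : ℕ) :
    IsFiniteLength (FrobeniusAlgebra A p e) (frobeniusSocleImage A p e) := by
  rw [← Module.length_ne_top_iff]
  refine ne_top_of_le_ne_top ?_ (length_le_length_of_isScalarTower A _ _)
  rw [length_frobeniusSocleImage hF e]
  exact ENat.natCast_ne_top _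

/-- The splitting number `a_e` is the rank of the residue pairing of `A^{(e)}`: the length over `A`
of the socle image is `[k : k ^ q]` times its length over `A^{(e)}`. -/
theorem splittingNumber_eq_finrank [IsNoetherianRing A] (hF : IsFFinite A p) (e : ℕ) :
    splittingNumber A p e = Module.finrank (ResidueField A)
      (residuePairingRange A (FrobeniusAlgebra A p e)) := by
  have := hF e
  have h₁ := FrobeniusAlgebra.length_eq_length_mul_frobeniusDegree_pow p e
    (isFiniteLength_frobeniusSocleImage hF e)
  rw [length_frobeniusSocleImage hF e] at h₁
  have h₂ := congrArg ENat.toNat h₁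
  rw [ENat.toNat_mul, ENat.toNat_natCast, ENat.toNat_natCast] at h₂
  have hp : (p : ℝ) ≠ 0 := Nat.cast_ne_zero.2 (Fact.out : p.Prime).ne_zero
  rw [splittingNumber_eq_mul hF, h₂, normalizedSplittingNumber]
  push_cast
  rw [mul_pow, ← pow_mul, mul_comm (natDim A), pow_mul]
  field_simp

end SplittingNumber

/-! ### Semicontinuity on the spectrum -/

section Spec

variable {R : Type u} [CommRing R] {p : ℕ} [Fact p.Prime] [CharP R p]

section Open

attribute [local instance] FrobeniusAlgebra.mapAlgebra FrobeniusAlgebra.compAlgebra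
  FrobeniusAlgebra.isScalarTower_base FrobeniusAlgebra.isScalarTower_map

/-- The splitting number at `P` is detected by `n × n` minors of the pairing of `R^{(e)}` with its
`R`-dual: fractions in `R_P` only contribute units to the determinant. -/
theorem natCast_le_splittingNumberAt_iff [IsNoetherianRing R] (hF : IsFFinite R p) (e n : ℕ)
    (P : PrimeSpectrum R) :
    (n : ℝ) ≤ splittingNumberAt p e P ↔
      ∃ (x : Fin n → FrobeniusAlgebra R p e) (f : Fin n → FrobeniusAlgebra R p e →ₗ[R] R),
        (Matrix.of fun i j => f i (x j)).det ∉ P.asIdeal := by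
  have hFP : IsFFinite (Localization.AtPrime P.asIdeal) p :=
    hF.of_isLocalization P.asIdeal.primeCompl
  have := hF e
  have := hFP e
  have := Module.finitePresentation_of_finite R (FrobeniusAlgebra R p e)
  rw [splittingNumberAt, splittingNumber_eq_finrank hFP, Nat.cast_le,
    le_finrank_residuePairingRange_iff]
  let A := Localization.AtPrime P.asIdeal
  let S := P.asIdeal.primeCompl
  let ι : FrobeniusAlgebra R p e →ₗ[R] FrobeniusAlgebra A p e :=
    (IsScalarTower.toAlgHom R (FrobeniusAlgebra R p e) (FrobeniusAlgebra A p e)).toLinearMap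
  have hι : IsLocalizedModule S ι := FrobeniusAlgebra.isLocalizedModule R A p e S
  have hunit : ∀ r : R, IsUnit (algebraMap R A r) ↔ r ∉ P.asIdeal := fun r =>
    IsLocalization.AtPrime.isUnit_to_map_iff A P.asIdeal r
  constructor
  · rintro ⟨x, f, hf⟩
    choose y hy using fun j => IsLocalizedModule.surj S ι (x j)
    choose g t hg using fun i => Module.FinitePresentation.exists_lift_of_isLocalizedModule S
      (Algebra.linearMap R A) (((f i).restrictScalars R) ∘ₗ ι)
    refine ⟨fun j => (y j).1, g, ?_⟩
    have hentry : ∀ i j, algebraMap R A (g i (y j).1) =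
        algebraMap R A (t i) * (algebraMap R A (y j).2 * f i (x j)) := fun i j => by
      have h₁ := LinearMap.congr_fun (hg i) (y j).1
      simp only [LinearMap.comp_apply, Algebra.linearMap_apply, LinearMap.smul_apply,
        LinearMap.restrictScalars_apply, ← hy j] at h₁
      rw [h₁, Submonoid.smul_def, Submonoid.smul_def, Algebra.smul_def,
        ← Algebra.smul_def ((y j).2 : R), ← LinearMap.map_smul_of_tower]
    rw [← hunit, RingHom.map_det]
    have hmat : (algebraMap R A).mapMatrix (Matrix.of fun i j => g i (y j).1) =
        Matrix.of fun i j => algebraMap R A (t i) *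
          (Matrix.of fun i j => algebraMap R A (y j).2 *
            (Matrix.of fun i j => f i (x j)) i j) i j := by
      ext i j
      exact hentry i j
    rw [hmat, Matrix.det_mul_column, Matrix.det_mul_row]
    refine IsUnit.mul ?_ (IsUnit.mul ?_ hf)
    · exact IsUnit.prod_iff.2 fun i _ => (hunit _).2 (t i).2
    · exact IsUnit.prod_iff.2 fun j _ => (hunit _).2 (y j).2.2
  · rintro ⟨x, f, hf⟩
    let g : Fin n → FrobeniusAlgebra A p e →ₗ[A] A := fun i =>
      LinearMap.extendScalarsOfIsLocalization S A
        (IsLocalizedModule.map S ι (Algebra.linearMap R A) (f i))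
    refine ⟨fun j => ι (x j), g, ?_⟩
    rw [← hunit, RingHom.map_det] at hf
    have hmat : (Matrix.of fun i j => g i (ι (x j))) =
        (algebraMap R A).mapMatrix (Matrix.of fun i j => f i (x j)) := by
      ext i j
      exact IsLocalizedModule.map_apply S ι (Algebra.linearMap R A) (f i) (x j)
    rwa [← hmat] at hf

end Open

theorem lowerSemicontinuous_splittingNumberAt [IsNoetherianRing R] (hF : IsFFinite R p) (e : ℕ) :
    LowerSemicontinuous fun P : PrimeSpectrum R => splittingNumberAt p e P := by
  intro P y hy
  have hFP : IsFFinite (Localization.AtPrime P.asIdeal) p :=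
    hF.of_isLocalization P.asIdeal.primeCompl
  obtain ⟨n, hn⟩ : ∃ n : ℕ, splittingNumberAt p e P = n := ⟨_, splittingNumber_eq_finrank hFP e⟩
  obtain ⟨x, f, hf⟩ := (natCast_le_splittingNumberAt_iff hF e n P).1 hn.ge
  refine Filter.mem_of_superset (PrimeSpectrum.isOpen_basicOpen.mem_nhds hf) fun Q hQ => ?_
  exact (hy.trans_eq hn).trans_le ((natCast_le_splittingNumberAt_iff hF e n Q).2 ⟨x, f, hQ⟩)

theorem ringKrullDim_eq_natDim (A : Type u) [CommRing A] [IsLocalRing A] [IsNoetherianRing A] :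
    ringKrullDim A = natDim A := by
  have h₁ := ringKrullDim_ne_top (R := A)
  have h₂ := ringKrullDim_ne_bot (R := A)
  rw [natDim]
  generalize ringKrullDim A = d at h₁ h₂
  lift d to ℕ∞ using h₂
  lift d to ℕ using fun h => h₁ (by rw [h]; rfl)
  rfl

variable (p) in
/-- The number `p ^ (dim R_P + α(R_P)) = p ^ dim R_P * [κ(P) : κ(P) ^ p]`, whose `e`-th power is the
ratio of the two splitting numbers at `P`. -/
noncomputable def splittingRatioAt (P : PrimeSpectrum R) : ℕ :=
  p ^ natDim (Localization.AtPrime P.asIdeal) *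
    frobeniusDegree (ResidueField (Localization.AtPrime P.asIdeal)) p

/-- By Kunz's formula for `R_P / p₀ R_P` and local equidimensionality, the ratio at `P` is the
degree `[κ(p₀) : κ(p₀) ^ p]` for every minimal prime `p₀` contained in `P`. -/
theorem splittingRatioAt_eq_frobeniusDegree [IsNoetherianRing R] (hF : IsFFinite R p)
    (hR : IsLocallyEquidimensional R) {P P₀ : PrimeSpectrum R}
    (h₀ : P₀.asIdeal ∈ minimalPrimes R) (h : P₀ ≤ P) :
    splittingRatioAt p P = frobeniusDegree P₀.asIdeal.ResidueField p := by
  let A := Localization.AtPrime P.asIdeal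
  have hdisj : Disjoint (P.asIdeal.primeCompl : Set R) P₀.asIdeal :=
    Set.disjoint_left.2 fun x hx hx₀ => hx (h hx₀)
  let 𝔭 : Ideal A := P₀.asIdeal.map (algebraMap R A)
  have hcomap : 𝔭.comap (algebraMap R A) = P₀.asIdeal :=
    IsLocalization.under_map_of_isPrime_disjoint P.asIdeal.primeCompl A P₀.2 hdisj
  have h𝔭 : 𝔭.IsPrime :=
    IsLocalization.isPrime_of_isPrime_disjoint P.asIdeal.primeCompl A _ P₀.2 hdisj
  have hmin : 𝔭 ∈ minimalPrimes A := by
    refine ⟨⟨h𝔭, bot_le⟩, fun 𝔮 h𝔮 hle => ?_⟩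
    have := h𝔮.1
    refine Ideal.map_le_iff_le_comap.2 (h₀.2 ⟨inferInstance, bot_le⟩ ?_)
    rw [← hcomap]
    exact Ideal.comap_mono hle
  have hdim : ringKrullDim (A ⧸ 𝔭) = natDim A :=
    (hR P 𝔭 hmin).trans (ringKrullDim_eq_natDim A)
  have hFA : IsFFinite A p := hF.of_isLocalization P.asIdeal.primeCompl
  have : CharP (A ⧸ 𝔭) p := charP_of_nontrivial_algebra (R := R) p _
  have : IsLocalRing (A ⧸ 𝔭) := .of_surjective' _ Ideal.Quotient.mk_surjective
  have : IsLocalHom (Ideal.Quotient.mk 𝔭) := .of_surjective _ Ideal.Quotient.mk_surjective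
  have h₁ := frobeniusDegree_fractionRing (D := A ⧸ 𝔭) (K := 𝔭.ResidueField)
    (hFA.of_surjective Ideal.Quotient.mk_surjective) hdim
  have h₂ := frobeniusDegree_congr p (RingEquiv.ofBijective _
    ((RingHom.surjectiveOnStalks_of_isLocalization P.asIdeal.primeCompl A).residueFieldMap_bijective
      P₀.asIdeal 𝔭 hcomap.symm))
  rw [h₂, h₁, splittingRatioAt, frobeniusDegree_congr p
    (ResidueField.equivOfSurjective (Ideal.Quotient.mk 𝔭) Ideal.Quotient.mk_surjective)]

/-- The ratio is constant on each irreducible component of `Spec R`, and these are finitely many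
closed sets. -/
theorem isLocallyConstant_splittingRatioAt [IsNoetherianRing R] (hF : IsFFinite R p)
    (hR : IsLocallyEquidimensional R) :
    IsLocallyConstant (splittingRatioAt p : PrimeSpectrum R → ℕ) := by
  intro s
  let T : Set (PrimeSpectrum R) := {P₀ | P₀.asIdeal ∈ minimalPrimes R ∧ splittingRatioAt p P₀ ∉ s}
  have hT : T.Finite := by
    refine Set.Finite.subset ((minimalPrimes.finite_of_isNoetherianRing R).preimage
      (f := PrimeSpectrum.asIdeal) ?_) fun P₀ h => h.1
    exact fun P _ Q _ h => PrimeSpectrum.ext h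
  have key : (splittingRatioAt p ⁻¹' s)ᶜ =
      ⋃ P₀ ∈ T, PrimeSpectrum.zeroLocus (P₀.asIdeal : Set R) := by
    ext P
    simp only [Set.mem_compl_iff, Set.mem_preimage, Set.mem_iUnion, PrimeSpectrum.mem_zeroLocus,
      SetLike.coe_subset_coe, exists_prop, T, Set.mem_ofPred_eq]
    constructor
    · intro h
      obtain ⟨I, hI, hIP⟩ := Ideal.exists_minimalPrimes_le (J := P.asIdeal) bot_le
      have h₁ := splittingRatioAt_eq_frobeniusDegree hF hR (P₀ := ⟨I, hI.1.1⟩) hI hIP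
      have h₂ := splittingRatioAt_eq_frobeniusDegree hF hR (P₀ := ⟨I, hI.1.1⟩) hI le_rfl
      exact ⟨⟨I, hI.1.1⟩, ⟨hI, by rwa [h₂, ← h₁]⟩, hIP⟩
    · rintro ⟨P₀, ⟨h₀, hs⟩, hle⟩
      rwa [splittingRatioAt_eq_frobeniusDegree hF hR h₀ hle,
        ← splittingRatioAt_eq_frobeniusDegree hF hR h₀ le_rfl]
  rw [← isClosed_compl_iff, key]
  exact hT.isClosed_biUnion fun P₀ _ => PrimeSpectrum.isClosed_zeroLocus _

theorem splittingRatioAt_pos (hF : IsFFinite R p) (P : PrimeSpectrum R) :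
    0 < splittingRatioAt p P :=
  Nat.mul_pos (pow_pos (Fact.out : p.Prime).pos _)
    (frobeniusDegree_residueField_pos (hF.of_isLocalization P.asIdeal.primeCompl))

theorem splittingNumberAt_eq_mul (hF : IsFFinite R p) (e : ℕ) (P : PrimeSpectrum R) :
    splittingNumberAt p e P =
      (splittingRatioAt p P : ℝ) ^ e * (normalizedSplittingNumberAt p e P : ℝ) := by
  have h := splittingNumber_eq_mul
    (hF.of_isLocalization (S := Localization.AtPrime P.asIdeal) P.asIdeal.primeCompl) e
  rw [splittingNumberAt, h, splittingRatioAt, normalizedSplittingNumberAt]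
  push_cast
  rfl

/-- Near `P` the function `s_e` is `a_e` divided by a positive constant. -/
theorem lowerSemicontinuous_normalizedSplittingNumberAt [IsNoetherianRing R] (hF : IsFFinite R p)
    (hR : IsLocallyEquidimensional R) (e : ℕ) :
    LowerSemicontinuous fun P : PrimeSpectrum R => (normalizedSplittingNumberAt p e P : ℝ) := by
  intro P y hy
  have hpos : (0 : ℝ) < (splittingRatioAt p P : ℝ) ^ e :=
    pow_pos (Nat.cast_pos.2 (splittingRatioAt_pos hF P)) e
  have h₁ := (mul_lt_mul_iff_right₀ hpos).2 hy
  rw [← splittingNumberAt_eq_mul hF e P] at h₁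
  filter_upwards [lowerSemicontinuous_splittingNumberAt hF e P _ h₁,
    (isLocallyConstant_splittingRatioAt hF hR).eventually_eq P] with Q hQ hQP
  rw [splittingNumberAt_eq_mul hF e Q, hQP] at hQ
  exact (mul_lt_mul_iff_right₀ hpos).1 hQ

end Spec

theorem mainTheorem5 {R : Type u} [CommRing R] [IsNoetherianRing R] (p : ℕ) [Fact p.Prime]
    [CharP R p] (hF : IsFFinite R p) (hR : IsLocallyEquidimensional R) :
    (∀ P : PrimeSpectrum R, IsFFinite (Localization.AtPrime P.asIdeal) p) ∧
    ∀ e : ℕ,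
      (∀ P : PrimeSpectrum R, ∃ r : ℚ, splittingNumberAt p e P = (r : ℝ)) ∧
      LowerSemicontinuous (fun P : PrimeSpectrum R => (normalizedSplittingNumberAt p e P : ℝ)) ∧
      LowerSemicontinuous (fun P : PrimeSpectrum R => splittingNumberAt p e P) ∧
      ∀ P₀ : PrimeSpectrum R, ∃ c : ℝ, 0 < c ∧ ∀ P ∈ connectedComponent P₀,
        splittingNumberAt p e P = c * (normalizedSplittingNumberAt p e P : ℝ) := by
  have hFP : ∀ P : PrimeSpectrum R, IsFFinite (Localization.AtPrime P.asIdeal) p := fun P =>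
    hF.of_isLocalization P.asIdeal.primeCompl
  refine ⟨hFP, fun e => ⟨fun P => ?_, lowerSemicontinuous_normalizedSplittingNumberAt hF hR e,
    lowerSemicontinuous_splittingNumberAt hF e, fun P₀ => ?_⟩⟩
  · refine ⟨((splittingRatioAt p P : ℚ) ^ e * normalizedSplittingNumberAt p e P : ℚ), ?_⟩
    rw [splittingNumberAt_eq_mul hF]
    push_cast
    rfl
  · refine ⟨(splittingRatioAt p P₀ : ℝ) ^ e,
      pow_pos (Nat.cast_pos.2 (splittingRatioAt_pos hF P₀)) e, fun P hP => ?_⟩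
    rw [splittingNumberAt_eq_mul hF,
      (isLocallyConstant_splittingRatioAt hF hR).apply_eq_of_isPreconnected
        isPreconnected_connectedComponent hP mem_connectedComponent]
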